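/- **Setting.** Let $n\ge 0$, let $\Omega\subseteq\mathbb R^n$ be open with the Euclidean distance $d$, and let $\mathcal P\subseteq\Omega$ be a (finite or infinite) set of points, called sites. - The Voronoi cell of $p\in\mathcal P$ in $\Omega$ is $V_\Omega(p)=\{x\in\Omega : d(x,p)\le d(x,q)\text{ for all } q\in\mathcal P\}$. The Delaunay complex $\mathrm{Del}_\Omega(\mathcal P)$ is the nerve of the Voronoi cells: the set of nonempty finite $\sigma\subseteq\mathcal P$ with $\bigcap_{p\in\sigma}V_\Omega(p)\neq\emptyset$. - $\mathcal P$ is an $(\varepsilon,\mu)$-net of $\Omega$ if every $x\in\Omega$ is at distance $<\varepsilon$ from some site, and $d(p,q)\ge\mu$ for all distinct $p,q\in\mathcal P$. - A Delaunay ball of $\sigma\in\mathrm{Del}_\Omega(\mathcal P)$ is a ball $B(c,r)$ with $c\in\Omega$, $d(c,p)=r$ for all $p\in\sigma$ and $d(c,q)\ge r$ for all $q\in\mathcal P$. $\mathcal P$ is $\delta$-power protected if every $\sigma\in\mathrm{Del}_\Omega(\mathcal P)$ (of any dimension) has a Delaunay ball $B(c,r)$ such that the closed ball $B(c,\sqrt{r^2+\delta^2})$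 contains no point of $\mathcal P\setminus\sigma$. - A canvas $\mathcal C$ of $\Omega$ is a triangulation of $\Omega$: a geometric simplicial complex in $\mathbb R^n$ (possibly infinite), locally finite at every point of $\Omega$, whose underlying space $|\mathcal C|$ satisfies $\Omega\subseteq|\mathcal C|\subseteq\overline\Omega$. Write $e_{\mathcal C}$ for the supremum of its edge lengths. Each canvas vertex is coloured with a closest site (an arbitrary one in case of a tie). - The discrete cell $V^{\mathrm d}(p)$ is the union of all closed canvas simplices that have at least one vertex of colour $p$. The discrete Delaunay complex $\mathrm{Del}^{\mathrm d}(\mathcal P)$ is the nerve of the discrete cells: the set of nonempty finite $\sigma\subseteq\mathcal P$ with $\bigcap_{p\in\sigma}V^{\mathrm d}(p)\ne\emptyset$. **Theorem.** Let $\mathcal P$ be a $\delta$-power protected $(\varepsilon,\mu)$-net of $\Omega$. Assume that the Voronoi cells $V_\Omega(p)$, $p\in\mathcal P$, are convex, and that the boundary of $\Omega$ plays no role for the Delaunay complex, in the sense that $\mathrm{Del}_\Omega(\mathcal P)=\mathrm{Del}_{\mathbb R^n}(\mathcal P)$. (Both assumptions hold trivially when $\Omega=\mathbb R^n$; the first holds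 whenever $\Omega$ is convex.) Let $\mathcal C$ be a canvas of $\Omega$. If $$e_{\mathcal C}<\min\left\{\frac{\mu}{16},\ \frac{\delta^2}{64\,\varepsilon}\right\},$$ then $\mathrm{Del}^{\mathrm d}(\mathcal P)=\mathrm{Del}_\Omega(\mathcal P)$, for every choice of the closest-site colouring. -/

import Mathlib

open scoped ENNReal

/-- The Voronoi cell of the site `p` in the domain `Ω`, for the Euclidean distance. -/
def voronoiCell {n : ℕ} (Ω P : Set (EuclideanSpace ℝ (Fin n))) (p : EuclideanSpace ℝ (Fin n)) :
    Set (EuclideanSpace ℝ (Fin n)) :=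
  {x | x ∈ Ω ∧ ∀ q ∈ P, dist x p ≤ dist x q}

/-- The Delaunay complex of `P` in `Ω`: the nerve of the Voronoi cells, as an abstract simplicial
complex whose simplices are nonempty finite sets of sites. -/
def delaunayComplex {n : ℕ} (Ω P : Set (EuclideanSpace ℝ (Fin n))) :
    Set (Finset (EuclideanSpace ℝ (Fin n))) :=
  {σ | σ.Nonempty ∧ (∀ p ∈ σ, p ∈ P) ∧ (⋂ p ∈ σ, voronoiCell Ω P p).Nonempty}

/-- `P` is an `(ε, μ)`-net of `Ω`: a set of sites of `Ω` that is an `ε`-sample of `Ω` and is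
`μ`-separated. -/
structure IsNet {n : ℕ} (Ω P : Set (EuclideanSpace ℝ (Fin n))) (ε μ : ℝ) : Prop where
  subset : P ⊆ Ω
  sample : ∀ x ∈ Ω, ∃ p ∈ P, dist x p < ε
  separated : ∀ p ∈ P, ∀ q ∈ P, p ≠ q → μ ≤ dist p q

/-- The ball with centre `c` and radius `r` is a Delaunay ball of the simplex `σ`: its centre lies
in `Ω`, its bounding sphere passes through the vertices of `σ`, and no site lies in its interior. -/
structure IsDelaunayBall {n : ℕ} (Ω P : Set (EuclideanSpace ℝ (Fin n)))
    (σ : Finset (EuclideanSpace ℝ (Fin n))) (c : EuclideanSpace ℝ (Fin n)) (r : ℝ) : Prop where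
  center_mem : c ∈ Ω
  circumscribes : ∀ p ∈ σ, dist c p = r
  empty : ∀ q ∈ P, r ≤ dist c q

/-- `P` is `δ`-power protected in `Ω`: every Delaunay simplex `σ`, of any dimension, has a Delaunay
ball `B(c, r)` whose dilation, the closed ball of radius `√(r² + δ²)` about `c`, contains no site
other than the vertices of `σ`. (An `n`-simplex has a single circumscribing ball.) -/
def IsPowerProtected {n : ℕ} (Ω P : Set (EuclideanSpace ℝ (Fin n))) (δ : ℝ) : Prop :=
  ∀ σ ∈ delaunayComplex Ω P, ∃ (c : EuclideanSpace ℝ (Fin n)) (r : ℝ),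
    IsDelaunayBall Ω P σ c r ∧
      ∀ q ∈ P, q ∉ σ → q ∉ Metric.closedBall c (Real.sqrt (r ^ 2 + δ ^ 2))

/-- The geometric simplicial complex `C` is a canvas of `Ω`, that is a triangulation of `Ω`, locally
finite in `Ω`. As `Ω` is open, the simplices may fill exactly `Ω` (with infinitely many simplices),
or its closure, or `Ω` together with a part of its frontier. -/
structure IsCanvas {n : ℕ} (Ω : Set (EuclideanSpace ℝ (Fin n)))
    (C : Geometry.SimplicialComplex ℝ (EuclideanSpace ℝ (Fin n))) : Prop where
  covers : Ω ⊆ C.space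
  space_subset : C.space ⊆ closure Ω
  locallyFinite : ∀ x ∈ Ω, ∃ U ∈ nhds x,
    {s | s ∈ C.faces ∧
      (convexHull ℝ (s : Set (EuclideanSpace ℝ (Fin n))) ∩ U).Nonempty}.Finite

/-- The supremum of the edge lengths of `C`, as an extended nonnegative real. -/
noncomputable def maxEdgeLength {n : ℕ}
    (C : Geometry.SimplicialComplex ℝ (EuclideanSpace ℝ (Fin n))) : ℝ≥0∞ :=
  ⨆ s ∈ C.faces, ⨆ u ∈ s, ⨆ v ∈ s, edist u v

/-- `col` colours each vertex of `C` with a closest site (any one of them in case of a tie); the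
colour of a site is the site itself. -/
def IsNearestSiteColouring {n : ℕ}
    (C : Geometry.SimplicialComplex ℝ (EuclideanSpace ℝ (Fin n)))
    (P : Set (EuclideanSpace ℝ (Fin n)))
    (col : EuclideanSpace ℝ (Fin n) → EuclideanSpace ℝ (Fin n)) : Prop :=
  ∀ v ∈ C.vertices, col v ∈ P ∧ ∀ q ∈ P, dist v (col v) ≤ dist v q

/-- The discrete Voronoi cell of `p`: the union of the (closed) simplices of `C` that have at least
one vertex of colour `p`. -/
def discreteVoronoiCell {n : ℕ}
    (C : Geometry.SimplicialComplex ℝ (EuclideanSpace ℝ (Fin n)))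
    (col : EuclideanSpace ℝ (Fin n) → EuclideanSpace ℝ (Fin n))
    (p : EuclideanSpace ℝ (Fin n)) : Set (EuclideanSpace ℝ (Fin n)) :=
  {x | ∃ s ∈ C.faces, (∃ v ∈ s, col v = p) ∧
    x ∈ convexHull ℝ (s : Set (EuclideanSpace ℝ (Fin n)))}

/-- The discrete Delaunay complex: the nerve of the discrete Voronoi cells of the sites. -/
def discreteDelaunayComplex {n : ℕ}
    (C : Geometry.SimplicialComplex ℝ (EuclideanSpace ℝ (Fin n)))
    (P : Set (EuclideanSpace ℝ (Fin n)))
    (col : EuclideanSpace ℝ (Fin n) → EuclideanSpace ℝ (Fin n)) :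
    Set (Finset (EuclideanSpace ℝ (Fin n))) :=
  {σ | σ.Nonempty ∧ (∀ p ∈ σ, p ∈ P) ∧ (⋂ p ∈ σ, discreteVoronoiCell C col p).Nonempty}

/-!
A site whose discrete cell contains `x` is at most `2e` farther from `x` than the nearest site,
where `e` is the maximal edge length; so its power distance to `x` exceeds the minimal one by less
than `δ ^ 2`. Let `σ` be a set of such sites, let `τ` be the set of the sites nearest to `x`, and
let `c` be a protected centre of `τ`. When `x` moves away from `c` along a ray, the sites of `τ`
remain equidistant and the power gap of each site of `σ \ τ`, which is smaller at `x` than at `c`,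
decreases, until a further site becomes nearest. The affine span of the nearest sites grows at each
such move, so that eventually `σ` consists of nearest sites and is a Delaunay simplex.

Conversely, let `σ` be a Delaunay simplex. Put protected centres of its faces at the vertices of a
cube with one coordinate for each site of `σ`, and interpolate them multilinearly on the union of
the lower faces of the cube. By convexity of the Voronoi cells the interpolation has values in `Ω`.
As the power gap of two sites is an affine function, the points taken to the discrete cell of `p`
avoid the face of the cube where the coordinate of `p` is `1`, and no discrete cell of a site
outside `σ` is met. A covering argument of Knaster-Kuratowski-Mazurkiewicz type then yields a point
common to the discrete cells of `σ`.

The covering argument rests on Brouwer's fixed point theorem for Lipschitz maps. If `g` is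
Lipschitz and vanishes outside a ball, then `id + t • g` maps the ball bijectively to itself for
small `t`, so that the integral over the ball of the Jacobian determinant of `id + t • g`, a
polynomial in `t`, is constantly the volume of the ball. For a retraction `id + g` of the ball onto
its boundary, however, this determinant vanishes almost everywhere.
-/

section FixedPoint

open MeasureTheory Module

theorem det_one_add_smul_eq_sum_lagrange_basis {F V : Type*} [Field F] [DecidableEq F]
    [AddCommGroup V] [Module F V] [FiniteDimensional F V] (A : Module.End F V) {s : Finset F}
    (hs : finrank F V < s.card) (t : F) :
    LinearMap.det (1 + t • A)
      = ∑ i ∈ s, LinearMap.det (1 + i • A) * (Lagrange.basis s id i).eval t := by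
  let b := finBasis F V
  let M := LinearMap.toMatrix b b A
  let p : Polynomial F :=
    ((Polynomial.X : Polynomial F) • M.map Polynomial.C + (1 : Matrix _ _ F).map Polynomial.C).det
  have eval_p (u : F) : p.eval u = LinearMap.det (1 + u • A) := by
    rw [← LinearMap.det_toMatrix b, ← Polynomial.coe_evalRingHom, RingHom.map_det]
    congr 1
    ext i j
    by_cases h : i = j <;> simp [M, h, add_comm, mul_comm u, LinearMap.toMatrix_one]
  have degree_p : p.degree < s.card :=
    Polynomial.degree_le_natDegree.trans_lt <| by
      exact_mod_cast (Polynomial.natDegree_det_X_add_C_le M 1).trans_lt (by simpa using hs)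
  rw [← eval_p, Lagrange.eq_interpolate (v := id) (Set.injOn_id _) degree_p,
    Lagrange.interpolate_apply, Polynomial.eval_finsetSum]
  simp [eval_p]

variable {E : Type*} [NormedAddCommGroup E] [NormedSpace ℝ E]

theorem det_one_add_ne_zero_of_norm_lt_one [CompleteSpace E] {A : E →L[ℝ] E} (hA : ‖A‖ < 1) :
    (1 + A).det ≠ 0 := by
  have isUnit_one_add : IsUnit (1 + A) := by
    simpa using isUnit_one_sub_of_norm_lt_one (x := -A) (by rwa [norm_neg])
  exact ((isUnit_one_add.map (ContinuousLinearMap.toLinearMapRingHom (R₁ := ℝ) (M₁ := E))).map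
    LinearMap.det).ne_zero

theorem det_one_add_pos_of_norm_lt_one [FiniteDimensional ℝ E] {A : E →L[ℝ] E} (hA : ‖A‖ < 1) :
    0 < (1 + A).det := by
  have := FiniteDimensional.complete ℝ E
  have continuous_det : Continuous fun t : ℝ => (1 + t • A).det :=
    ContinuousLinearMap.continuous_det.comp (by fun_prop)
  by_contra! hle
  obtain ⟨t, ht, det_eq_zero⟩ := intermediate_value_Icc' zero_le_one continuous_det.continuousOn
    (show (0 : ℝ) ∈ Set.Icc _ _ from ⟨by simpa using hle, by simp [ContinuousLinearMap.det]⟩)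
  refine det_one_add_ne_zero_of_norm_lt_one ?_ det_eq_zero
  rw [norm_smul, Real.norm_of_nonneg ht.1]
  exact (mul_le_of_le_one_left (norm_nonneg A) ht.2).trans_lt hA

theorem bijective_id_add_of_lipschitzWith_lt_one [CompleteSpace E] {K : NNReal} (hK : K < 1)
    {g : E → E} (hg : LipschitzWith K g) : Function.Bijective fun x => x + g x := by
  have approximates_id : ApproximatesLinearOn (fun x => x + g x)
      ((ContinuousLinearEquiv.refl ℝ E : E ≃L[ℝ] E) : E →L[ℝ] E) Set.univ K :=
    ApproximatesLinearOn.approximatesLinearOn_iff_lipschitzOnWith.2 <| by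
      apply LipschitzWith.lipschitzOnWith
      convert hg using 1
      ext x
      simp
  have small : Subsingleton E ∨
      K < ‖((ContinuousLinearEquiv.refl ℝ E).symm : E →L[ℝ] E)‖₊⁻¹ := by
    refine (subsingleton_or_nontrivial E).imp_right fun (_ : Nontrivial E) => ?_
    simpa [ContinuousLinearMap.nnnorm_id (𝕜 := ℝ) (E := E)] using hK
  exact ⟨Set.injOn_univ.1 (approximates_id.injOn small), approximates_id.surjective small⟩

theorem image_id_add_eq_of_bijective {G : Type*} [AddZeroClass G] {g : G → G} {s : Set G}
    (hg : Function.Bijective fun x => x + g x) (h0 : ∀ x ∉ s, g x = 0) :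
    (fun x => x + g x) '' s = s := by
  have image_compl : (fun x => x + g x) '' sᶜ = sᶜ :=
    Set.EqOn.image_eq_self fun x hx => by simp [h0 x hx]
  rwa [Set.image_compl_eq hg, compl_inj_iff] at image_compl

theorem det_eq_zero_of_isLocalMax_norm [FiniteDimensional ℝ E] {f : E → E} {A : E →L[ℝ] E} {x : E}
    (hf : HasFDerivAt f A x) (hmax : IsLocalMax (fun y => ‖f y‖) x) (hx : f x ≠ 0) :
    A.det = 0 := by
  by_contra hdet
  have surjective_A : Function.Surjective A :=
    ((Module.End.isUnit_iff _).1
      ((LinearMap.isUnit_iff_isUnit_det (A : E →ₗ[ℝ] E)).2 (isUnit_iff_ne_zero.2 hdet))).2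
  obtain ⟨h, hh⟩ := surjective_A (f x)
  obtain ⟨φ, norm_φ, hφ⟩ := exists_dual_vector ℝ (f x) (norm_ne_zero_iff.2 hx)
  have hmaxφ : IsLocalMax (fun y => φ (f y)) x := by
    filter_upwards [hmax] with y hy
    calc φ (f y) ≤ ‖φ (f y)‖ := le_abs_self _
      _ ≤ ‖f y‖ := by simpa [norm_φ] using φ.le_opNorm (f y)
      _ ≤ φ (f x) := by simpa [hφ] using hy
  have deriv_eq_zero : φ (A h) = 0 :=
    congrArg (fun B : E →L[ℝ] ℝ => B h) (hmaxφ.hasFDerivAt_eq_zero (φ.hasFDerivAt.comp x hf))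
  rw [hh, hφ] at deriv_eq_zero
  exact hx (by simpa using deriv_eq_zero)

section Jacobian

variable [MeasurableSpace E] [BorelSpace E] (ν : Measure E) [ν.IsAddHaarMeasure]

theorem addHaar_image_eq_zero_of_lipschitzWith [FiniteDimensional ℝ E] {K : NNReal} {f : E → E}
    (hf : LipschitzWith K f) {s : Set E} (hs : ν s = 0) : ν (f '' s) = 0 := by
  have hausdorff_eq_zero : μH[finrank ℝ E] s = 0 :=
    Measure.absolutelyContinuous_isAddHaarMeasure _ ν hs
  refine Measure.absolutelyContinuous_isAddHaarMeasure ν μH[finrank ℝ E] (le_bot_iff.1 ?_)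
  simpa [hausdorff_eq_zero] using hf.hausdorffMeasure_image_le (Nat.cast_nonneg (finrank ℝ E)) s

theorem integral_det_one_add_fderiv_of_lipschitzWith_lt_one [FiniteDimensional ℝ E] {K : NNReal}
    (hK : K < 1) {g : E → E} (hg : LipschitzWith K g) {s : Set E} (hs : MeasurableSet s)
    (hfin : ν s ≠ ∞) (h0 : ∀ x ∉ s, g x = 0) :
    IntegrableOn (fun x => (1 + fderiv ℝ g x).det) s ν ∧
      ∫ x in s, (1 + fderiv ℝ g x).det ∂ν = ν.real s := by
  have := FiniteDimensional.complete ℝ E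
  set D := {x | DifferentiableAt ℝ g x}
  set f : E → E := fun x => x + g x
  have D_ae : ∀ᵐ x ∂ν, x ∈ D := hg.ae_differentiableAt
  have sD_measurable : MeasurableSet (s ∩ D) := hs.inter (measurableSet_of_differentiableAt ℝ g)
  have f_bijective : Function.Bijective f := bijective_id_add_of_lipschitzWith_lt_one hK hg
  have sD_ae_eq : (s ∩ D : Set E) =ᵐ[ν] s :=
    inter_ae_eq_left_of_ae_eq_univ (Filter.eventuallyEq_univ.2 D_ae)
  have measure_image : ν (f '' (s ∩ D)) = ν s := by
    have image_s : f '' s = s := image_id_add_eq_of_bijective f_bijective h0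
    have null_image : ν (f '' (s \ D)) = 0 :=
      addHaar_image_eq_zero_of_lipschitzWith ν (LipschitzWith.id.add hg)
        (measure_mono_null (Set.sdiff_subset_compl s D) D_ae)
    rw [← measure_congr (union_ae_eq_left_of_ae_eq_empty (ae_eq_empty.2 null_image)),
      ← Set.image_union, Set.inter_union_sdiff, image_s]
  have f_deriv : ∀ x ∈ s ∩ D, HasFDerivWithinAt f (1 + fderiv ℝ g x) (s ∩ D) x := fun x hx =>
    ((hasFDerivAt_id x).add hx.2.hasFDerivAt).hasFDerivWithinAt
  have abs_det : ∀ x, |(1 + fderiv ℝ g x).det| = (1 + fderiv ℝ g x).det := fun x =>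
    abs_of_pos (det_one_add_pos_of_norm_lt_one
      ((norm_fderiv_le_of_lipschitz ℝ hg).trans_lt hK))
  rw [← integrableOn_congr_set_ae sD_ae_eq, ← setIntegral_congr_set sD_ae_eq]
  constructor
  · simpa [abs_det] using (integrableOn_image_iff_integrableOn_abs_det_fderiv_smul ν sD_measurable
      f_deriv f_bijective.1.injOn fun _ => (1 : ℝ)).1
        (integrableOn_const (by rwa [measure_image]))
  · simpa [abs_det, measure_image, Measure.real] using
      (integral_image_eq_integral_abs_det_fderiv_smul ν sD_measurable f_deriv
        f_bijective.1.injOn fun _ => (1 : ℝ)).symm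

theorem integral_det_one_add_fderiv [FiniteDimensional ℝ E] {K : NNReal} {g : E → E}
    (hg : LipschitzWith K g) {s : Set E} (hs : MeasurableSet s) (hfin : ν s ≠ ∞)
    (h0 : ∀ x ∉ s, g x = 0) : ∫ x in s, (1 + fderiv ℝ g x).det ∂ν = ν.real s := by
  obtain ⟨T, hT, T_card⟩ :=
    (Set.Ioo_infinite (show (0 : ℝ) < ((K : ℝ) + 1)⁻¹ by positivity)).exists_subset_card_eq
      (finrank ℝ E + 1)
  have of_mem : ∀ t ∈ T, IntegrableOn (fun x => (1 + t • fderiv ℝ g x).det) s ν ∧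
      ∫ x in s, (1 + t • fderiv ℝ g x).det ∂ν = ν.real s := by
    intro t ht
    obtain ⟨t_pos, t_lt⟩ := hT ht
    have tK_lt : ‖t‖₊ * K < 1 := by
      rw [← NNReal.coe_lt_coe]
      push_cast
      rw [Real.norm_of_nonneg t_pos.le]
      rw [lt_inv_comm₀ t_pos (by positivity)] at t_lt
      calc t * K < t * t⁻¹ := by gcongr; linarith
        _ = 1 := mul_inv_cancel₀ t_pos.ne'
    have fderiv_smul : fderiv ℝ (t • g) = t • fderiv ℝ g := fderiv_const_smul_field t
    have smul_lipschitz : LipschitzWith (‖t‖₊ * K) (t • g) := (lipschitzWith_smul t).comp hg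
    simpa only [fderiv_smul, Pi.smul_apply] using
      integral_det_one_add_fderiv_of_lipschitzWith_lt_one ν tK_lt smul_lipschitz hs hfin
        fun x hx => by simp [h0 x hx]
  have det_eq_sum (x : E) : (1 + fderiv ℝ g x).det
      = ∑ t ∈ T, (1 + t • fderiv ℝ g x).det * (Lagrange.basis T id t).eval 1 := by
    have lagrange := det_one_add_smul_eq_sum_lagrange_basis (fderiv ℝ g x : E →ₗ[ℝ] E)
      (show finrank ℝ E < T.card by omega) 1
    rwa [one_smul] at lagrange
  simp_rw [det_eq_sum]
  rw [integral_finsetSum _ fun t ht => (of_mem t ht).1.mul_const _]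
  simp_rw [integral_mul_const]
  rw [Finset.sum_congr rfl fun t ht => by rw [(of_mem t ht).2], ← Finset.mul_sum,
    ← Polynomial.eval_finsetSum, Lagrange.sum_basis (Set.injOn_id _)
      (Finset.card_pos.1 (by omega))]
  simp

end Jacobian

theorem exists_norm_ne_of_lipschitzWith_of_eqOn_compl_ball [FiniteDimensional ℝ E] {K : NNReal}
    {f : E → E} (hf : LipschitzWith K f) {R : ℝ} (hR : 0 < R)
    (hid : Set.EqOn f id (Metric.ball 0 R)ᶜ) : ∃ x ∈ Metric.ball 0 R, ‖f x‖ ≠ R := by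
  by_contra! hnorm
  borelize E
  let ν : Measure E := Measure.addHaar
  set g : E → E := fun x => f x - x
  have hg : LipschitzWith (K + 1) g := hf.sub LipschitzWith.id
  have integral_eq : ∫ x in Metric.ball 0 R, (1 + fderiv ℝ g x).det ∂ν
      = ν.real (Metric.ball (0 : E) R) :=
    integral_det_one_add_fderiv ν hg measurableSet_ball measure_ball_lt_top.ne
      fun x hx => sub_eq_zero.2 (hid hx)
  have det_ae_eq_zero : ∀ᵐ x ∂ν, x ∈ Metric.ball 0 R → (1 + fderiv ℝ g x).det = 0 := by
    filter_upwards [hg.ae_differentiableAt] with x differentiable_at hxB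
    have f_deriv : HasFDerivAt f (1 + fderiv ℝ g x) x := by
      convert (hasFDerivAt_id x).add differentiable_at.hasFDerivAt using 1
      · ext y
        simp [g]
      · rfl
    refine det_eq_zero_of_isLocalMax_norm f_deriv ?_ (norm_pos_iff.1 (by rwa [hnorm x hxB]))
    filter_upwards [Metric.isOpen_ball.mem_nhds hxB] with y hy
    rw [hnorm x hxB, hnorm y hy]
  rw [setIntegral_eq_zero_of_ae_eq_zero det_ae_eq_zero] at integral_eq
  exact (ENNReal.toReal_pos (Metric.measure_ball_pos ν _ hR).ne' measure_ball_lt_top.ne).ne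
    integral_eq

theorem lipschitzWith_inv_max_norm_smul {m : NNReal} (hm : 0 < m) :
    LipschitzWith (2 / m) fun x : E => (max (m : ℝ) ‖x‖)⁻¹ • x := by
  refine LipschitzWith.of_dist_le_mul fun x y => ?_
  rw [dist_eq_norm, dist_eq_norm]
  push_cast
  set a := max (m : ℝ) ‖x‖
  set b := max (m : ℝ) ‖y‖
  have hm0 : (0 : ℝ) < m := hm
  have a_pos : 0 < a := lt_max_of_lt_left hm0
  have b_pos : 0 < b := lt_max_of_lt_left hm0
  have a_inv_le : a⁻¹ ≤ (m : ℝ)⁻¹ := inv_anti₀ hm0 (le_max_left _ _)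
  have abs_sub_le : |b - a| ≤ ‖x - y‖ := by
    rw [norm_sub_rev]
    exact (abs_max_sub_max_le_max _ _ _ _).trans (by simpa using abs_norm_sub_norm_le y x)
  have y_le : b⁻¹ * ‖y‖ ≤ 1 := (inv_mul_le_one₀ b_pos).2 (le_max_right _ _)
  calc ‖a⁻¹ • x - b⁻¹ • y‖ = ‖a⁻¹ • (x - y) + ((b - a) * a⁻¹ * b⁻¹) • y‖ := by
        rw [show (b - a) * a⁻¹ * b⁻¹ = a⁻¹ - b⁻¹ by field_simp, smul_sub, sub_smul]
        abel_nf
    _ ≤ a⁻¹ * ‖x - y‖ + |b - a| * a⁻¹ * (b⁻¹ * ‖y‖) := by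
        refine (norm_add_le _ _).trans_eq ?_
        rw [norm_smul, norm_smul, norm_mul, norm_mul, Real.norm_of_nonneg (inv_pos.2 a_pos).le,
          Real.norm_of_nonneg (inv_pos.2 b_pos).le, Real.norm_eq_abs, mul_assoc _ b⁻¹]
    _ ≤ (m : ℝ)⁻¹ * ‖x - y‖ + ‖x - y‖ * (m : ℝ)⁻¹ * 1 := by gcongr
    _ = 2 / m * ‖x - y‖ := by ring

theorem exists_eq_zero_of_lipschitzWith_of_eqOn_compl_ball [FiniteDimensional ℝ E] {K : NNReal}
    {f : E → E} (hf : LipschitzWith K f) {R : NNReal} (hR : 0 < R)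
    (hid : Set.EqOn f id (Metric.ball 0 R)ᶜ) : ∃ x, f x = 0 := by
  by_contra! hne
  have := FiniteDimensional.proper ℝ E
  obtain ⟨x₀, -, hx₀⟩ := (isCompact_closedBall (0 : E) R).exists_isMinOn
    ⟨0, by simp⟩ hf.continuous.nnnorm.continuousOn
  have f_eq {x : E} (hx : R ≤ ‖x‖) : f x = x := hid (by simpa using hx)
  set m := min R ‖f x₀‖₊
  have hm : 0 < m := lt_min hR (nnnorm_pos.2 (hne x₀))
  have m_le (x : E) : m ≤ ‖f x‖₊ := by
    rcases le_total ‖x‖ R with hx | hx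
    · exact (min_le_right _ _).trans (hx₀ (by simpa using hx))
    · rw [f_eq hx]
      exact (min_le_left _ _).trans hx
  let F : E → E := fun x =>
    (R : ℝ) • (max (m : ℝ) ‖f x‖)⁻¹ • f x - (R : ℝ) • (max (R : ℝ) ‖x‖)⁻¹ • x + x
  have hF : LipschitzWith _ F :=
    (((lipschitzWith_smul (R : ℝ)).comp ((lipschitzWith_inv_max_norm_smul hm).comp hf)).sub
      ((lipschitzWith_smul (R : ℝ)).comp (lipschitzWith_inv_max_norm_smul hR))).add LipschitzWith.id
  have normalizes_f (x : E) : max (m : ℝ) ‖f x‖ = ‖f x‖ := max_eq_right (m_le x)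
  obtain ⟨x, hx, norm_ne⟩ := exists_norm_ne_of_lipschitzWith_of_eqOn_compl_ball hF hR fun x hx => by
    have hx' : (R : ℝ) ≤ ‖x‖ := by simpa using hx
    simp [F, normalizes_f, f_eq hx', max_eq_right hx']
  refine norm_ne ?_
  have hx' : ‖x‖ ≤ R := by simpa using (Metric.mem_ball.1 hx).le
  have R_ne : (R : ℝ) ≠ 0 := (NNReal.coe_pos.2 hR).ne'
  simp [F, normalizes_f, max_eq_left hx', smul_inv_smul₀ R_ne, norm_smul,
    norm_ne_zero_iff.2 (hne x)]

theorem exists_isFixedPt_of_lipschitzWith_of_forall_mem_Icc {ι : Type*} [Fintype ι] {K : NNReal}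
    {f : (ι → ℝ) → ι → ℝ} (hf : LipschitzWith K f) (hmem : ∀ a, f a ∈ Set.Icc 0 1) :
    ∃ a, Function.IsFixedPt f a := by
  -- `cutoff` vanishes outside a ball, and its fixed points are fixed points of `f`.
  let cutoff : (ι → ℝ) → ι → ℝ := fun a i => min (f a i) (max 0 (2 - ‖a‖))
  have cutoff_lipschitz : LipschitzWith (max K 1) cutoff := by
    refine LipschitzWith.of_dist_le_mul fun a b => (dist_pi_le_iff (by positivity)).2 fun i => ?_
    have hnorm : LipschitzWith 1 fun a : ι → ℝ => max 0 (2 - ‖a‖) := by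
      simpa using ((LipschitzWith.const (2 : ℝ)).sub lipschitzWith_one_norm).const_max 0
    simpa using (((LipschitzWith.eval i).comp hf).min hnorm).dist_le_mul a b
  obtain ⟨a, ha⟩ := exists_eq_zero_of_lipschitzWith_of_eqOn_compl_ball
    (f := fun a => a - cutoff a) (LipschitzWith.id.sub cutoff_lipschitz) (R := 2) two_pos
    fun a ha => by
      have norm_ge : 2 ≤ ‖a‖ := by simpa using ha
      ext i
      have h0 : 0 ≤ f a i := (hmem a).1 i
      simp [cutoff, norm_ge, h0]
  have a_eq (i : ι) : a i = cutoff a i := congrFun (sub_eq_zero.1 ha) i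
  have norm_le : ‖a‖ ≤ 1 := (pi_norm_le_iff_of_nonneg zero_le_one).2 fun i => by
    rw [a_eq, Real.norm_of_nonneg (le_min ((hmem a).1 i) (le_max_left _ _))]
    exact (min_le_left _ _).trans ((hmem a).2 i)
  refine ⟨a, funext fun i => ((a_eq i).trans (min_eq_left ?_)).symm⟩
  calc f a i ≤ 1 := (hmem a).2 i
    _ ≤ 2 - ‖a‖ := by linarith
    _ ≤ max 0 (2 - ‖a‖) := le_max_right _ _

end FixedPoint

section KKM

/-- The union of the faces of the unit cube through the origin. It is a ball whose boundary is
covered by the pieces `{a i = 1}`, and it replaces the standard simplex, these pieces being its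
facets, in the covering theorem `nonempty_iInter_of_isClosed_of_forall_ne_one`: a retraction onto it
has a simple formula. -/
def cubeLowerFaces (ι : Type*) : Set (ι → ℝ) :=
  {a | a ∈ Set.Icc 0 1 ∧ ∃ i, a i = 0}

variable {ι : Type*}

theorem isCompact_cubeLowerFaces [Finite ι] : IsCompact (cubeLowerFaces ι) := by
  have isClosed_exists : IsClosed {a : ι → ℝ | ∃ i, a i = 0} := by
    rw [Set.ofPred_exists]
    exact isClosed_iUnion_of_finite fun i => isClosed_eq (continuous_apply i) continuous_const
  exact isCompact_Icc.inter_right isClosed_exists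

/-- A Lipschitz retraction of the quadrant onto `cubeLowerFaces ι`: translate along the diagonal
until some coordinate vanishes, then truncate the coordinates at `1`. -/
noncomputable def cubeLowerFacesRetraction (a : ι → ℝ) : ι → ℝ :=
  fun i => min (a i - ⨅ j, a j) 1

variable [Nonempty ι]

theorem cubeLowerFacesRetraction_mem [Finite ι] (a : ι → ℝ) :
    cubeLowerFacesRetraction a ∈ cubeLowerFaces ι := by
  refine ⟨⟨fun i => le_min ?_ zero_le_one, fun i => min_le_right _ _⟩, ?_⟩
  · exact sub_nonneg.2 (ciInf_le (Finite.bddBelow_range a) i)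
  · obtain ⟨i, hi⟩ := exists_eq_ciInf_of_finite (f := a)
    exact ⟨i, by simp [cubeLowerFacesRetraction, hi]⟩

theorem cubeLowerFacesRetraction_eq_self [Finite ι] {a : ι → ℝ} (ha : a ∈ cubeLowerFaces ι) :
    cubeLowerFacesRetraction a = a := by
  obtain ⟨⟨h0, h1⟩, i, hi⟩ := ha
  have iInf_eq : ⨅ j, a j = 0 :=
    le_antisymm (hi ▸ ciInf_le (Finite.bddBelow_range a) i) (le_ciInf h0)
  ext j
  simpa [cubeLowerFacesRetraction, iInf_eq] using h1 j

theorem lipschitzWith_iInf_apply [Fintype ι] : LipschitzWith 1 fun a : ι → ℝ => ⨅ j, a j := by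
  refine LipschitzWith.of_le_add fun a b => ?_
  rw [← sub_le_iff_le_add]
  refine le_ciInf fun j => ?_
  rw [sub_le_iff_le_add]
  calc ⨅ j, a j ≤ a j := ciInf_le (Finite.bddBelow_range a) j
    _ ≤ b j + dist (a j) (b j) := by linarith [Real.dist_eq (a j) (b j), le_abs_self (a j - b j)]
    _ ≤ b j + dist a b := by gcongr; exact dist_le_pi_dist a b j

theorem lipschitzWith_cubeLowerFacesRetraction [Fintype ι] :
    LipschitzWith 2 (cubeLowerFacesRetraction : (ι → ℝ) → ι → ℝ) := by
  refine LipschitzWith.of_dist_le_mul fun a b => (dist_pi_le_iff (by positivity)).2 fun i => ?_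
  have coordinate := ((LipschitzWith.eval i).sub lipschitzWith_iInf_apply).min_const (1 : ℝ)
  rw [one_add_one_eq_two] at coordinate
  exact coordinate.dist_le_mul a b

/-- If the closed sets did not meet, the coordinates of a fixed point of the thickened indicators of
the `B i`, composed with the retraction, could not all be positive; so the fixed point would lie in
`cubeLowerFaces ι`, in some `B i`, and have `i`-th coordinate `1`. -/
theorem nonempty_iInter_of_isClosed_of_forall_ne_one [Finite ι] {B : ι → Set (ι → ℝ)}
    (hclosed : ∀ i, IsClosed (B i)) (hcover : cubeLowerFaces ι ⊆ ⋃ i, B i)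
    (hne : ∀ i, ∀ a ∈ B i, a i ≠ 1) : (⋂ i, B i).Nonempty := by
  have := Fintype.ofFinite ι
  by_contra! hempty
  obtain ⟨δ, δ_pos, lebesgue⟩ := lebesgue_number_lemma_of_metric isCompact_cubeLowerFaces
    (fun i => (hclosed i).isOpen_compl) (by simp [← Set.compl_iInter, hempty])
  let Φ : (ι → ℝ) → ι → ℝ := fun a i =>
    thickenedIndicator δ_pos (B i) (cubeLowerFacesRetraction a)
  have Φ_lipschitz : LipschitzWith (δ.toNNReal⁻¹ * 2) Φ :=
    LipschitzWith.of_dist_le_mul fun a b => (dist_pi_le_iff (by positivity)).2 fun i =>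
      ((lipschitzWith_thickenedIndicator δ_pos (B i)).comp
        lipschitzWith_cubeLowerFacesRetraction).dist_le_mul a b
  have Φ_mem (a : ι → ℝ) : Φ a ∈ Set.Icc 0 1 :=
    ⟨fun i => NNReal.coe_nonneg _, fun i => by exact_mod_cast thickenedIndicator_le_one δ_pos _ _⟩
  obtain ⟨a, ha⟩ := exists_isFixedPt_of_lipschitzWith_of_forall_mem_Icc Φ_lipschitz Φ_mem
  have a_mem : a ∈ cubeLowerFaces ι := by
    obtain ⟨i, ball_subset⟩ := lebesgue _ (cubeLowerFacesRetraction_mem a)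
    have not_mem : cubeLowerFacesRetraction a ∉ Metric.thickening δ (B i) := fun h => by
      obtain ⟨b, hb, dist_lt⟩ := Metric.mem_thickening_iff.1 h
      exact ball_subset (Metric.mem_ball'.2 dist_lt) hb
    have Φ_eq_zero : Φ a i = 0 := by
      simp only [Φ, thickenedIndicator_zero δ_pos _ not_mem, NNReal.coe_zero]
    exact ⟨ha ▸ Φ_mem a, i, ha ▸ Φ_eq_zero⟩
  obtain ⟨j, hj⟩ := Set.mem_iUnion.1 (hcover a_mem)
  have Φ_eq_one : Φ a j = 1 := by
    simp only [Φ, cubeLowerFacesRetraction_eq_self a_mem, thickenedIndicator_one δ_pos _ hj,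
      NNReal.coe_one]
  exact hne j a hj (ha ▸ Φ_eq_one)

end KKM

section NearestSites

open Filter Topology

/-- The set of the sites of `P` at minimal distance from `x`. -/
def nearestSites {X : Type*} [Dist X] (P : Set X) (x : X) : Set X :=
  {p | p ∈ P ∧ ∀ q ∈ P, dist x p ≤ dist x q}

/-- `c` is a `δ`-power protected centre of the set of sites `τ`: the sites of `τ` are nearest to `c`
and every other site has a power distance to `c` larger by more than `δ ^ 2`. -/
structure IsProtectedCentre {X : Type*} [Dist X] (P : Set X) (δ : ℝ) (τ : Set X) (c : X) :
    Prop where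
  subset_nearestSites : τ ⊆ nearestSites P c
  gap : ∀ p ∈ τ, ∀ q ∈ P, q ∉ τ → dist c p ^ 2 + δ ^ 2 < dist c q ^ 2

theorem dist_eq_of_mem_nearestSites {X : Type*} [Dist X] {P : Set X} {x p q : X}
    (hp : p ∈ nearestSites P x) (hq : q ∈ nearestSites P x) : dist x p = dist x q :=
  le_antisymm (hp.2 q hq.1) (hq.2 p hp.1)

theorem mem_nearestSites_of_dist_eq {X : Type*} [Dist X] {P : Set X} {x p q : X}
    (hp : p ∈ nearestSites P x) (hq : q ∈ P) (h : dist x p = dist x q) : q ∈ nearestSites P x :=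
  ⟨hq, h ▸ hp.2⟩

theorem isClosed_setOf_mem_nearestSites {X : Type*} [PseudoMetricSpace X] (P : Set X) (p : X) :
    IsClosed {x | p ∈ nearestSites P x} := by
  have eq_inter :
      {x | p ∈ nearestSites P x} = {_x | p ∈ P} ∩ ⋂ q ∈ P, {x | dist x p ≤ dist x q} := by
    ext x
    simp [nearestSites]
  rw [eq_inter]
  exact isClosed_const.inter <| isClosed_biInter fun q _ => isClosed_le (by fun_prop) (by fun_prop)

section Separated

variable {X : Type*} [MetricSpace X] [ProperSpace X] {P : Set X} {μ : ℝ} (hμ : 0 < μ)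
  (hP : P.Pairwise fun p q => μ ≤ dist p q)

include hμ hP

theorem finite_nearestSites_of_pairwise_le_dist (x : X) : (nearestSites P x).Finite := by
  rcases (nearestSites P x).eq_empty_or_nonempty with h | ⟨p₀, hp₀⟩
  · simp [h]
  have discrete : IsDiscrete P := ⟨DiscreteTopology.of_forall_le_dist hμ fun p q hpq =>
    hP p.2 q.2 (Subtype.coe_injective.ne hpq)⟩
  refine (Metric.finite_isBounded_inter_isClosed discrete
    (Metric.isBounded_closedBall (x := x) (r := dist x p₀))
    (Metric.isClosed_of_pairwise_le_dist hμ hP)).subset fun p hp => ⟨?_, hp.1⟩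
  exact Metric.mem_closedBall'.2 (hp.2 p₀ hp₀.1)

theorem nonempty_nearestSites_of_pairwise_le_dist (hne : P.Nonempty) (x : X) :
    (nearestSites P x).Nonempty := by
  obtain ⟨p, hp, infDist_eq⟩ :=
    (Metric.isClosed_of_pairwise_le_dist hμ hP).exists_infDist_eq_dist hne x
  exact ⟨p, hp, fun q hq => infDist_eq ▸ Metric.infDist_le_dist_of_mem hq⟩

theorem eventually_nearestSites_subset_of_pairwise_le_dist (x : X) :
    ∀ᶠ y in 𝓝 x, nearestSites P y ⊆ nearestSites P x := by
  rcases (P \ nearestSites P x).eq_empty_or_nonempty with h | hother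
  · exact .of_forall fun y p hp => Set.sdiff_eq_empty.1 h hp.1
  obtain ⟨q, ⟨hqP, hq⟩, infDist_eq⟩ := (Metric.isClosed_of_pairwise_le_dist hμ
    (hP.mono Set.sdiff_subset)).exists_infDist_eq_dist hother x
  obtain ⟨p, hp⟩ := nonempty_nearestSites_of_pairwise_le_dist hμ hP ⟨q, hqP⟩ x
  have dist_lt : dist x p < Metric.infDist x (P \ nearestSites P x) := by
    rw [infDist_eq]
    exact (hp.2 q hqP).lt_of_ne fun h => hq (mem_nearestSites_of_dist_eq hp hqP h)
  have eventually_lt : ∀ᶠ y in 𝓝 x, dist y p < Metric.infDist y (P \ nearestSites P x) :=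
    (continuous_id.dist continuous_const).continuousAt.eventually_lt
      (Metric.continuous_infDist_pt _).continuousAt dist_lt
  filter_upwards [eventually_lt] with y hy r hr
  by_contra hrx
  exact (hr.2 p hp.1).not_gt (hy.trans_le (Metric.infDist_le_dist_of_mem ⟨hr.1, hrx⟩))

end Separated

section PowerDifference

variable {V : Type*} [NormedAddCommGroup V] [InnerProductSpace ℝ V]

theorem dist_sq_sub_dist_sq (z p q : V) :
    dist z q ^ 2 - dist z p ^ 2 = ‖q‖ ^ 2 - ‖p‖ ^ 2 - 2 * inner ℝ z (q - p) := by
  rw [dist_eq_norm, dist_eq_norm, norm_sub_sq_real, norm_sub_sq_real, inner_sub_right]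
  ring

theorem dist_sq_sub_dist_sq_add_smul_sub (x c p q : V) (t : ℝ) :
    dist (x + t • (x - c)) q ^ 2 - dist (x + t • (x - c)) p ^ 2
      = (1 + t) * (dist x q ^ 2 - dist x p ^ 2) - t * (dist c q ^ 2 - dist c p ^ 2) := by
  simp only [dist_sq_sub_dist_sq, inner_add_left, inner_smul_left, inner_sub_left,
    RCLike.conj_to_real]
  ring

theorem dist_add_smul_sub_eq {x c p q : V} (hx : dist x p = dist x q) (hc : dist c p = dist c q)
    (t : ℝ) : dist (x + t • (x - c)) p = dist (x + t • (x - c)) q := by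
  have power_eq := dist_sq_sub_dist_sq_add_smul_sub x c p q t
  rw [hx, hc, sub_self, sub_self, mul_zero, mul_zero, sub_zero, sub_eq_zero] at power_eq
  exact ((pow_left_inj₀ dist_nonneg dist_nonneg two_ne_zero).1 power_eq).symm

theorem convex_setOf_dist_sq_add_le (p q : V) (b : ℝ) :
    Convex ℝ {z : V | dist z p ^ 2 + b ≤ dist z q ^ 2} := by
  have eq_halfSpace : {z : V | dist z p ^ 2 + b ≤ dist z q ^ 2}
      = {z | innerSL ℝ (q - p) z ≤ (‖q‖ ^ 2 - ‖p‖ ^ 2 - b) / 2} := by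
    ext z
    have power_eq := dist_sq_sub_dist_sq z p q
    rw [real_inner_comm] at power_eq
    simp only [Set.mem_ofPred_eq, innerSL_apply_apply]
    constructor <;> intro h <;> linarith
  rw [eq_halfSpace]
  exact convex_halfSpace_le (innerSL ℝ (q - p)).isLinear _

theorem vectorSpan_lt_vectorSpan_of_dist_eq {τ τ' : Set V} (hττ' : τ ⊆ τ') {y c p₀ q : V}
    (hp₀ : p₀ ∈ τ) (hq : q ∈ τ') (hy : ∀ p ∈ τ', dist y p = dist y p₀)
    (hc : ∀ p ∈ τ, dist c p = dist c p₀) (hcq : dist c p₀ ≠ dist c q) :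
    vectorSpan ℝ τ < vectorSpan ℝ τ' := by
  refine lt_of_le_not_ge (vectorSpan_mono ℝ hττ') fun hle => ?_
  have inner_eq (r : V) (hr : r ∈ τ') :
      2 * inner ℝ (y - c) (r - p₀) = dist c r ^ 2 - dist c p₀ ^ 2 := by
    have hyr := dist_sq_sub_dist_sq y p₀ r
    have hcr := dist_sq_sub_dist_sq c p₀ r
    rw [hy r hr] at hyr
    rw [inner_sub_left]
    linarith
  have orthogonal : vectorSpan ℝ τ ≤ (ℝ ∙ (y - c))ᗮ := by
    rw [vectorSpan_eq_span_vsub_set_right ℝ hp₀, Submodule.span_le]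
    rintro _ ⟨r, hr, rfl⟩
    have := inner_eq r (hττ' hr)
    rw [hc r hr, sub_self] at this
    exact Submodule.mem_orthogonal_singleton_iff_inner_right.2 (by simpa using this)
  have q_orthogonal := Submodule.mem_orthogonal_singleton_iff_inner_right.1
    (orthogonal (hle (vsub_mem_vectorSpan ℝ hq (hττ' hp₀))))
  have := inner_eq q hq
  rw [vsub_eq_sub] at q_orthogonal
  rw [q_orthogonal, mul_zero, eq_comm, sub_eq_zero] at this
  exact hcq ((pow_left_inj₀ dist_nonneg dist_nonneg two_ne_zero).1 this).symm

theorem exists_isGreatest_mem_nearestSites_add_smul_sub {P : Set V} {x c p q : V}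
    (hp : p ∈ nearestSites P x) (hq : q ∈ P)
    (h : dist x q ^ 2 - dist x p ^ 2 < dist c q ^ 2 - dist c p ^ 2) :
    ∃ T, IsGreatest {t : ℝ | 0 ≤ t ∧ p ∈ nearestSites P (x + t • (x - c))} T := by
  have isClosed : IsClosed {t : ℝ | 0 ≤ t ∧ p ∈ nearestSites P (x + t • (x - c))} :=
    isClosed_Ici.inter ((isClosed_setOf_mem_nearestSites P p).preimage (by fun_prop))
  have bddAbove : BddAbove {t : ℝ | 0 ≤ t ∧ p ∈ nearestSites P (x + t • (x - c))} := by
    refine ⟨(dist x q ^ 2 - dist x p ^ 2) /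
      (dist c q ^ 2 - dist c p ^ 2 - (dist x q ^ 2 - dist x p ^ 2)), fun t ht => ?_⟩
    rw [le_div_iff₀ (sub_pos.2 h)]
    have dist_le := pow_le_pow_left₀ dist_nonneg (ht.2.2 q hq) 2
    linarith [dist_sq_sub_dist_sq_add_smul_sub x c p q t]
  exact ⟨_, isClosed.isGreatest_csSup ⟨0, le_rfl, by simpa using hp⟩ bddAbove⟩

variable [FiniteDimensional ℝ V] {P : Set V} {μ δ : ℝ} (hμ : 0 < μ)
  (hP : P.Pairwise fun p q => μ ≤ dist p q)

include hμ hP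

theorem exists_mem_nearestSites_sdiff_of_isGreatest {x c p : V} {τ : Set V}
    (hτ : ∀ q ∈ τ, dist x p = dist x q ∧ dist c p = dist c q) {T : ℝ}
    (hT : IsGreatest {t : ℝ | 0 ≤ t ∧ p ∈ nearestSites P (x + t • (x - c))} T) :
    ∃ q ∈ nearestSites P (x + T • (x - c)), q ∉ τ := by
  have := FiniteDimensional.proper ℝ V
  obtain ⟨⟨T_nonneg, p_nearest⟩, T_greatest⟩ := hT
  by_contra! hsub
  have ray_continuous : Tendsto (fun t : ℝ => x + t • (x - c)) (𝓝[>] T) (𝓝 (x + T • (x - c))) :=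
    (by fun_prop : Continuous fun t : ℝ => x + t • (x - c)).continuousWithinAt
  obtain ⟨t, nearest_subset, T_lt⟩ := ((ray_continuous.eventually
    (eventually_nearestSites_subset_of_pairwise_le_dist hμ hP _)).and self_mem_nhdsWithin).exists
  obtain ⟨q, hq⟩ := nonempty_nearestSites_of_pairwise_le_dist hμ hP ⟨p, p_nearest.1⟩
    (x + t • (x - c))
  have hqτ := hτ q (hsub q (nearest_subset hq))
  exact (T_greatest ⟨T_nonneg.trans (le_of_lt T_lt), mem_nearestSites_of_dist_eq hq p_nearest.1
    (dist_add_smul_sub_eq hqτ.1 hqτ.2 t).symm⟩).not_gt T_lt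

/-- The point `y` is the last one on the ray from `x` away from `c` to which the sites nearest to
`x` are still nearest. -/
theorem exists_nearestSites_ssubset_of_isProtectedCentre {x c : V}
    (hc : IsProtectedCentre P δ (nearestSites P x) c) {σ : Set V} (hσP : σ ⊆ P)
    (hσ : ∀ p ∈ σ, ∀ q ∈ P, dist x p ^ 2 < dist x q ^ 2 + δ ^ 2) (hsub : ¬ σ ⊆ nearestSites P x) :
    ∃ y, nearestSites P x ⊂ nearestSites P y ∧
      ∀ p ∈ σ, ∀ q ∈ P, dist y p ^ 2 < dist y q ^ 2 + δ ^ 2 := by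
  have := FiniteDimensional.proper ℝ V
  obtain ⟨p₁, hp₁, p₁_not_nearest⟩ := Set.not_subset.1 hsub
  obtain ⟨p, hp⟩ := nonempty_nearestSites_of_pairwise_le_dist hμ hP ⟨p₁, hσP hp₁⟩ x
  have decreasing (r : V) (hr : r ∈ σ) (hrx : r ∉ nearestSites P x) :
      dist x r ^ 2 - dist x p ^ 2 < dist c r ^ 2 - dist c p ^ 2 := by
    linarith [hσ r hr p hp.1, hc.gap p hp r (hσP hr) hrx]
  have equidistant : ∀ r ∈ nearestSites P x, dist x p = dist x r ∧ dist c p = dist c r :=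
    fun r hr => ⟨dist_eq_of_mem_nearestSites hp hr, dist_eq_of_mem_nearestSites
      (hc.subset_nearestSites hp) (hc.subset_nearestSites hr)⟩
  obtain ⟨T, hT⟩ := exists_isGreatest_mem_nearestSites_add_smul_sub hp (hσP hp₁)
    (decreasing p₁ hp₁ p₁_not_nearest)
  obtain ⟨⟨T_nonneg, p_nearest⟩, -⟩ := id hT
  have nearest_subset : nearestSites P x ⊆ nearestSites P (x + T • (x - c)) := fun r hr =>
    mem_nearestSites_of_dist_eq p_nearest hr.1
      (dist_add_smul_sub_eq (equidistant r hr).1 (equidistant r hr).2 T)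
  refine ⟨x + T • (x - c), (Set.ssubset_iff_exists.2 ⟨nearest_subset,
    exists_mem_nearestSites_sdiff_of_isGreatest hμ hP equidistant hT⟩), fun r hr q hq => ?_⟩
  have p_le : dist (x + T • (x - c)) p ^ 2 ≤ dist (x + T • (x - c)) q ^ 2 :=
    pow_le_pow_left₀ dist_nonneg (p_nearest.2 q hq) 2
  by_cases hrx : r ∈ nearestSites P x
  · have δ_pos : 0 < δ ^ 2 := by
      have := hσ p₁ hp₁ p hp.1
      have := pow_le_pow_left₀ dist_nonneg (hp.2 p₁ (hσP hp₁)) 2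
      linarith
    rw [dist_eq_of_mem_nearestSites (nearest_subset hrx) p_nearest]
    linarith
  · nlinarith [decreasing r hr hrx, hσ r hr p hp.1, dist_sq_sub_dist_sq_add_smul_sub x c p r T]

/-- A point with the given gaps whose nearest sites span a maximal direction cannot be improved by
`exists_nearestSites_ssubset_of_isProtectedCentre`. -/
theorem exists_subset_nearestSites_of_dist_sq_lt
    (hprot : ∀ x, ∃ c, IsProtectedCentre P δ (nearestSites P x) c) {σ : Set V} (hσP : σ ⊆ P) {x : V}
    (hx : ∀ p ∈ σ, ∀ q ∈ P, dist x p ^ 2 < dist x q ^ 2 + δ ^ 2) :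
    ∃ z, σ ⊆ nearestSites P z := by
  have := FiniteDimensional.proper ℝ V
  obtain ⟨_, ⟨z, hz, rfl⟩, z_max⟩ := (wellFounded_gt (α := Submodule ℝ V)).has_min
    ((fun z => vectorSpan ℝ (nearestSites P z)) ''
      {z | ∀ p ∈ σ, ∀ q ∈ P, dist z p ^ 2 < dist z q ^ 2 + δ ^ 2}) ⟨_, x, hx, rfl⟩
  by_contra! hsub
  obtain ⟨c, hc⟩ := hprot z
  obtain ⟨y, ⟨z_subset, not_subset⟩, hy⟩ :=
    exists_nearestSites_ssubset_of_isProtectedCentre hμ hP hc hσP hz (hsub z)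
  obtain ⟨q, hq, hqz⟩ := Set.not_subset.1 not_subset
  obtain ⟨p, hp⟩ := nonempty_nearestSites_of_pairwise_le_dist hμ hP ⟨q, hq.1⟩ z
  refine z_max _ ⟨y, hy, rfl⟩ (vectorSpan_lt_vectorSpan_of_dist_eq z_subset hp hq
    (fun r hr => dist_eq_of_mem_nearestSites hr (z_subset hp)) (fun r hr =>
      dist_eq_of_mem_nearestSites (hc.subset_nearestSites hr) (hc.subset_nearestSites hp)) ?_)
  intro h
  have := hc.gap p hp q hq.1 hqz
  rw [h] at this
  linarith [sq_nonneg δ]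

end PowerDifference

end NearestSites

section CubeInterpolation

variable {ι : Type*} [Fintype ι] [DecidableEq ι]

/-- The multilinear weight at `a` of the vertex of the unit cube that vanishes exactly on `τ`. -/
def cubeWeight (a : ι → ℝ) (τ : Finset ι) : ℝ :=
  (∏ i ∈ τ, (1 - a i)) * ∏ i ∈ Finset.univ \ τ, a i

theorem sum_cubeWeight (a : ι → ℝ) : ∑ τ, cubeWeight a τ = 1 := by
  simpa [cubeWeight] using (Finset.prod_add (fun i => 1 - a i) a Finset.univ).symm

theorem cubeWeight_nonneg {a : ι → ℝ} (ha : a ∈ Set.Icc 0 1) (τ : Finset ι) :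
    0 ≤ cubeWeight a τ :=
  mul_nonneg (Finset.prod_nonneg fun i _ => sub_nonneg.2 (ha.2 i))
    (Finset.prod_nonneg fun i _ => ha.1 i)

theorem mem_of_cubeWeight_ne_zero {a : ι → ℝ} {τ : Finset ι} (h : cubeWeight a τ ≠ 0) {i : ι}
    (hi : a i = 0) : i ∈ τ := by
  by_contra hiτ
  exact h (mul_eq_zero_of_right _ (Finset.prod_eq_zero (by simpa using hiτ) hi))

theorem ne_one_of_cubeWeight_ne_zero {a : ι → ℝ} {τ : Finset ι} (h : cubeWeight a τ ≠ 0) {i : ι}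
    (hi : i ∈ τ) : a i ≠ 1 := fun ai_eq =>
  h (mul_eq_zero_of_left (Finset.prod_eq_zero hi (sub_eq_zero.2 ai_eq.symm)) _)

variable {V : Type*} [AddCommGroup V] [Module ℝ V]

/-- The multilinear map on the cube with value `c τ` at the vertex that vanishes exactly on `τ`. -/
def cubeInterpolation (c : Finset ι → V) (a : ι → ℝ) : V :=
  ∑ τ, cubeWeight a τ • c τ

theorem continuous_cubeInterpolation [TopologicalSpace V] [ContinuousAdd V] [ContinuousSMul ℝ V]
    (c : Finset ι → V) : Continuous (cubeInterpolation c) := by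
  unfold cubeInterpolation cubeWeight
  fun_prop

theorem cubeInterpolation_mem {S : Set V} (hS : Convex ℝ S) {c : Finset ι → V} {a : ι → ℝ}
    (ha : a ∈ Set.Icc 0 1)
    (hc : ∀ τ : Finset ι, (∀ i, a i = 0 → i ∈ τ) → (∀ i ∈ τ, a i ≠ 1) → c τ ∈ S) :
    cubeInterpolation c a ∈ S := by
  rw [cubeInterpolation, ← finsum_eq_sum_of_fintype]
  refine hS.finsum_mem (cubeWeight_nonneg ha) ?_ fun τ hτ =>
    hc τ (fun _ => mem_of_cubeWeight_ne_zero hτ) fun _ => ne_one_of_cubeWeight_ne_zero hτ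
  rw [finsum_eq_sum_of_fintype, sum_cubeWeight]

theorem dist_cubeInterpolation_sq_add_le {E : Type*} [NormedAddCommGroup E] [InnerProductSpace ℝ E]
    {P : Set E} {δ : ℝ} {p : ι → E} {c : Finset ι → E}
    (hc : ∀ τ : Finset ι, τ.Nonempty → IsProtectedCentre P δ (p '' τ) (c τ)) {a : ι → ℝ}
    (ha : a ∈ Set.Icc 0 1) {i : ι} (hi : a i = 0) {q : E} (hq : q ∈ P)
    (hqa : ∀ j, p j = q → a j = 1) :
    dist (cubeInterpolation c a) (p i) ^ 2 + δ ^ 2 ≤ dist (cubeInterpolation c a) q ^ 2 := by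
  refine cubeInterpolation_mem (convex_setOf_dist_sq_add_le (p i) q (δ ^ 2)) ha
    fun τ zeros_mem ne_one => ?_
  have i_mem := zeros_mem i hi
  refine ((hc τ ⟨i, i_mem⟩).gap _ (Set.mem_image_of_mem p i_mem) q hq ?_).le
  rintro ⟨j, hj, hjq⟩
  exact ne_one j hj (hqa j hjq)

end CubeInterpolation

section Delaunay

open scoped NNReal

variable {n : ℕ} {Ω P : Set (EuclideanSpace ℝ (Fin n))} {ε μ δ : ℝ} {e : ℝ≥0}
  {C : Geometry.SimplicialComplex ℝ (EuclideanSpace ℝ (Fin n))}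
  {col : EuclideanSpace ℝ (Fin n) → EuclideanSpace ℝ (Fin n)}
  {σ : Finset (EuclideanSpace ℝ (Fin n))} {x p q : EuclideanSpace ℝ (Fin n)}

theorem mem_delaunayComplex_iff :
    σ ∈ delaunayComplex Ω P ↔ σ.Nonempty ∧ ∃ x ∈ Ω, ↑σ ⊆ nearestSites P x := by
  constructor
  · rintro ⟨⟨p, hp⟩, hσP, x, hx⟩
    rw [Set.mem_iInter₂] at hx
    exact ⟨⟨p, hp⟩, x, (hx p hp).1, fun q hq => ⟨hσP q hq, (hx q hq).2⟩⟩
  · rintro ⟨hne, x, hxΩ, hσ⟩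
    exact ⟨hne, fun p hp => (hσ hp).1, x, Set.mem_iInter₂.2 fun p hp => ⟨hxΩ, (hσ hp).2⟩⟩

theorem IsPowerProtected.exists_isProtectedCentre (hprot : IsPowerProtected Ω P δ)
    (hσ : σ ∈ delaunayComplex Ω P) : ∃ c ∈ Ω, IsProtectedCentre P δ σ c := by
  obtain ⟨c, r, ball, outside⟩ := hprot σ hσ
  refine ⟨c, ball.center_mem, fun p hp => ⟨hσ.2.1 p hp, fun q hq => ?_⟩, fun p hp q hq hqσ => ?_⟩
  · exact (ball.circumscribes p hp).trans_le (ball.empty q hq)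
  · rw [ball.circumscribes p hp]
    exact Real.lt_sq_of_sqrt_lt (not_le.1 (Metric.mem_closedBall'.not.1 (outside q hq hqσ)))

theorem IsNet.pairwise_le_dist (hnet : IsNet Ω P ε μ) : P.Pairwise fun p q => μ ≤ dist p q :=
  fun p hp q hq => hnet.separated p hp q hq

theorem IsNet.pos_of_mem_closure (hnet : IsNet Ω P ε μ) (hx : x ∈ closure Ω) : 0 < ε := by
  obtain ⟨y, hy⟩ := closure_nonempty_iff.1 ⟨x, hx⟩
  obtain ⟨p, -, dist_lt⟩ := hnet.sample y hy
  exact dist_nonneg.trans_lt dist_lt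

theorem exists_isProtectedCentre_nearestSites (hnet : IsNet Ω P ε μ) (hμ : 0 < μ)
    (hprot : IsPowerProtected Ω P δ)
    (hboundary : delaunayComplex Ω P = delaunayComplex Set.univ P)
    (x : EuclideanSpace ℝ (Fin n)) : ∃ c, IsProtectedCentre P δ (nearestSites P x) c := by
  rcases (nearestSites P x).eq_empty_or_nonempty with hempty | hne
  · exact ⟨x, by simp [hempty], by simp [hempty]⟩
  have hfin := finite_nearestSites_of_pairwise_le_dist hμ hnet.pairwise_le_dist x
  have nearest_mem : hfin.toFinset ∈ delaunayComplex Ω P := by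
    rw [hboundary, mem_delaunayComplex_iff]
    exact ⟨hfin.toFinset_nonempty.2 hne, x, Set.mem_univ x, hfin.coe_toFinset.subset⟩
  obtain ⟨c, -, hc⟩ := hprot.exists_isProtectedCentre nearest_mem
  exact ⟨c, hfin.coe_toFinset ▸ hc⟩

theorem dist_le_of_maxEdgeLength_le (he : maxEdgeLength C ≤ e)
    {s : Finset (EuclideanSpace ℝ (Fin n))} (hs : s ∈ C.faces) {v : EuclideanSpace ℝ (Fin n)}
    (hv : v ∈ s) (hx : x ∈ convexHull ℝ (s : Set (EuclideanSpace ℝ (Fin n)))) : dist x v ≤ e := by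
  refine convexHull_min (fun u hu => Metric.mem_closedBall.2 ?_) (convex_closedBall v e) hx
  simp only [maxEdgeLength, iSup_le_iff] at he
  exact edist_le_coe.1 (he s hs u hu v hv)

theorem mem_vertices_of_mem_face {s : Finset (EuclideanSpace ℝ (Fin n))} (hs : s ∈ C.faces)
    {v : EuclideanSpace ℝ (Fin n)} (hv : v ∈ s) : v ∈ C.vertices :=
  C.down_closed hs (Finset.singleton_subset_iff.2 hv) (Finset.singleton_nonempty v)

section EdgeBound

variable (hcol : IsNearestSiteColouring C P col) (he : maxEdgeLength C ≤ e)

include hcol he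

theorem dist_le_dist_add_of_mem_discreteVoronoiCell (hx : x ∈ discreteVoronoiCell C col p)
    (hq : q ∈ P) : dist x p ≤ dist x q + 2 * e := by
  obtain ⟨s, hs, ⟨v, hv, rfl⟩, hxs⟩ := hx
  have dist_xv := dist_le_of_maxEdgeLength_le he hs hv hxs
  calc dist x (col v) ≤ dist x v + dist v (col v) := dist_triangle _ _ _
    _ ≤ dist x v + dist v q := by gcongr; exact (hcol v (mem_vertices_of_mem_face hs hv)).2 q hq
    _ ≤ dist x v + (dist x v + dist x q) := by gcongr; exact dist_triangle_left v q x
    _ ≤ dist x q + 2 * e := by linarith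

theorem dist_le_add_of_mem_discreteVoronoiCell (hnet : IsNet Ω P ε μ) (hxΩ : x ∈ closure Ω)
    (hx : x ∈ discreteVoronoiCell C col p) : dist x p ≤ ε + 2 * e := by
  refine le_of_forall_pos_le_add fun γ γ_pos => ?_
  obtain ⟨y, hy, dist_xy⟩ := Metric.mem_closure_iff.1 hxΩ γ γ_pos
  obtain ⟨q, hq, dist_yq⟩ := hnet.sample y hy
  linarith [dist_le_dist_add_of_mem_discreteVoronoiCell hcol he hx hq, dist_triangle x y q]

theorem dist_sq_lt_of_mem_discreteVoronoiCell (hnet : IsNet Ω P ε μ) (heμ : 6 * e < μ)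
    (heδ : 8 * ε * e < δ ^ 2) (hxΩ : x ∈ closure Ω) (hx : x ∈ discreteVoronoiCell C col p)
    (hp : p ∈ P) (hq : q ∈ P) : dist x p ^ 2 < dist x q ^ 2 + δ ^ 2 := by
  have ε_pos := hnet.pos_of_mem_closure hxΩ
  refine lt_of_le_of_lt ?_ (add_lt_add_right heδ _)
  rcases le_or_gt (dist x p) (dist x q) with hle | hlt
  · have : 0 ≤ 8 * ε * e := by positivity
    linarith [pow_le_pow_left₀ dist_nonneg hle 2]
  have dist_p_le := dist_le_dist_add_of_mem_discreteVoronoiCell hcol he hx hq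
  have dist_p_le' := dist_le_add_of_mem_discreteVoronoiCell hcol he hnet hxΩ hx
  have e_le_ε : (e : ℝ) ≤ ε := by
    have separated := hnet.separated p hp q hq fun h => hlt.ne' (h ▸ rfl)
    linarith [dist_triangle_left p q x]
  calc dist x p ^ 2 ≤ (min (dist x q) ε + 2 * e) ^ 2 := by
        gcongr
        rw [← min_add_add_right]
        exact le_min dist_p_le dist_p_le'
    _ = min (dist x q) ε ^ 2 + 4 * e * (min (dist x q) ε + e) := by ring
    _ ≤ dist x q ^ 2 + 4 * e * (ε + ε) := by
        have : 0 ≤ min (dist x q) ε := le_min dist_nonneg ε_pos.le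
        gcongr
        · exact min_le_left _ _
        · exact min_le_right _ _
    _ = dist x q ^ 2 + 8 * ε * e := by ring

end EdgeBound

theorem discreteDelaunayComplex_subset (hnet : IsNet Ω P ε μ) (hprot : IsPowerProtected Ω P δ)
    (hboundary : delaunayComplex Ω P = delaunayComplex Set.univ P) (hC : IsCanvas Ω C)
    (hcol : IsNearestSiteColouring C P col) (he : maxEdgeLength C ≤ e) (heμ : 6 * e < μ)
    (heδ : 8 * ε * e < δ ^ 2) : discreteDelaunayComplex C P col ⊆ delaunayComplex Ω P := by
  rintro σ ⟨⟨p₀, hp₀⟩, hσP, x, hx⟩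
  rw [Set.mem_iInter₂] at hx
  have hxΩ : x ∈ closure Ω := by
    obtain ⟨s, hs, -, hxs⟩ := hx p₀ hp₀
    exact hC.space_subset (Geometry.SimplicialComplex.mem_space_iff.2 ⟨s, hs, hxs⟩)
  have μ_pos : 0 < μ := lt_of_le_of_lt (by positivity) heμ
  rw [hboundary, mem_delaunayComplex_iff]
  obtain ⟨z, hz⟩ := exists_subset_nearestSites_of_dist_sq_lt μ_pos hnet.pairwise_le_dist
    (exists_isProtectedCentre_nearestSites hnet μ_pos hprot hboundary) hσP fun p hp q hq =>
      dist_sq_lt_of_mem_discreteVoronoiCell hcol he hnet heμ heδ hxΩ (hx p hp) (hσP p hp) hq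
  exact ⟨⟨p₀, hp₀⟩, z, Set.mem_univ z, hz⟩

theorem isClosed_preimage_discreteVoronoiCell (hC : IsCanvas Ω C)
    (col : EuclideanSpace ℝ (Fin n) → EuclideanSpace ℝ (Fin n)) (p : EuclideanSpace ℝ (Fin n)) :
    IsClosed ((↑) ⁻¹' discreteVoronoiCell C col p : Set Ω) := by
  have eq_iUnion : ((↑) ⁻¹' discreteVoronoiCell C col p : Set Ω)
      = ⋃ s : {s ∈ C.faces | ∃ v ∈ s, col v = p},
        (↑) ⁻¹' convexHull ℝ (s.1 : Set (EuclideanSpace ℝ (Fin n))) := by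
    ext x
    simp [discreteVoronoiCell, and_assoc]
  rw [eq_iUnion]
  refine LocallyFinite.isClosed_iUnion (fun x => ?_) fun s =>
    (s.1.finite_toSet.isClosed_convexHull ℝ).preimage continuous_subtype_val
  obtain ⟨U, hU, hfin⟩ := hC.locallyFinite x x.2
  refine ⟨(↑) ⁻¹' U, preimage_coe_mem_nhds_subtype.2 (mem_nhdsWithin_of_mem_nhds hU),
    (hfin.preimage Subtype.val_injective.injOn).subset ?_⟩
  rintro s ⟨y, hys, hyU⟩
  exact ⟨s.2.1, y, hys, hyU⟩

theorem exists_mem_discreteVoronoiCell (hC : IsCanvas Ω C) (hcol : IsNearestSiteColouring C P col)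
    (hx : x ∈ Ω) : ∃ p ∈ P, x ∈ discreteVoronoiCell C col p := by
  obtain ⟨s, hs, hxs⟩ := Geometry.SimplicialComplex.mem_space_iff.1 (hC.covers hx)
  obtain ⟨v, hv⟩ := C.nonempty_of_mem_faces hs
  exact ⟨col v, (hcol v (mem_vertices_of_mem_face hs hv)).1, s, hs, ⟨v, hv, rfl⟩, hxs⟩

theorem exists_forall_isProtectedCentre (hprot : IsPowerProtected Ω P δ)
    (hσ : σ ∈ delaunayComplex Ω P) : ∃ c : Finset σ → EuclideanSpace ℝ (Fin n),
      ∀ τ : Finset σ, τ.Nonempty → c τ ∈ Ω ∧ IsProtectedCentre P δ ((↑) '' (τ : Set σ)) (c τ) := by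
  classical
  obtain ⟨-, x, hxΩ, σ_nearest⟩ := mem_delaunayComplex_iff.1 hσ
  have exists_centre (τ : Finset σ) : ∃ c, τ.Nonempty →
      c ∈ Ω ∧ IsProtectedCentre P δ ((↑) '' (τ : Set σ)) c := by
    by_cases hτ : τ.Nonempty
    · have image_mem : τ.image (↑) ∈ delaunayComplex Ω P :=
        mem_delaunayComplex_iff.2 ⟨hτ.image _, x, hxΩ, by
          rw [Finset.coe_image]
          exact (Subtype.coe_image_subset _ _).trans σ_nearest⟩
      obtain ⟨c, hcΩ, hc⟩ := hprot.exists_isProtectedCentre image_mem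
      exact ⟨c, fun _ => ⟨hcΩ, by simpa using hc⟩⟩
    · exact ⟨x, fun h => absurd h hτ⟩
  choose c hc using exists_centre
  exact ⟨c, hc⟩

theorem cubeInterpolation_mem_voronoiCell {ι : Type*} [Fintype ι] [DecidableEq ι]
    {v : ι → EuclideanSpace ℝ (Fin n)} {c : Finset ι → EuclideanSpace ℝ (Fin n)}
    (hc : ∀ τ : Finset ι, τ.Nonempty → c τ ∈ Ω ∧ IsProtectedCentre P δ (v '' τ) (c τ)) {i : ι}
    (hconvex : Convex ℝ (voronoiCell Ω P (v i))) {a : ι → ℝ} (ha : a ∈ Set.Icc 0 1)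
    (hi : a i = 0) : cubeInterpolation c a ∈ voronoiCell Ω P (v i) := by
  refine cubeInterpolation_mem hconvex ha fun τ zeros_mem _ => ?_
  obtain ⟨centre_mem, centre⟩ := hc τ ⟨i, zeros_mem i hi⟩
  exact ⟨centre_mem, (centre.subset_nearestSites (Set.mem_image_of_mem v (zeros_mem i hi))).2⟩

theorem exists_apply_ne_one_of_cubeInterpolation_mem_discreteVoronoiCell {ι : Type*} [Fintype ι]
    [DecidableEq ι] (hnet : IsNet Ω P ε μ) (hcol : IsNearestSiteColouring C P col)
    (he : maxEdgeLength C ≤ e) (heμ : 6 * e < μ) (heδ : 8 * ε * e < δ ^ 2)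
    {v : ι → EuclideanSpace ℝ (Fin n)} (hv : ∀ i, v i ∈ P)
    {c : Finset ι → EuclideanSpace ℝ (Fin n)}
    (hc : ∀ τ : Finset ι, τ.Nonempty → IsProtectedCentre P δ (v '' τ) (c τ)) {a : ι → ℝ}
    (ha : a ∈ cubeLowerFaces ι) (hΩ : cubeInterpolation c a ∈ closure Ω) (hq : q ∈ P)
    (hmem : cubeInterpolation c a ∈ discreteVoronoiCell C col q) : ∃ j, v j = q ∧ a j ≠ 1 := by
  obtain ⟨ha, i, hi⟩ := ha
  by_contra! hqa
  linarith [dist_cubeInterpolation_sq_add_le hc ha hi hq hqa,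
    dist_sq_lt_of_mem_discreteVoronoiCell hcol he hnet heμ heδ hΩ hmem hq (hv i)]

theorem delaunayComplex_subset (hnet : IsNet Ω P ε μ) (hprot : IsPowerProtected Ω P δ)
    (hconvex : ∀ p ∈ P, Convex ℝ (voronoiCell Ω P p)) (hC : IsCanvas Ω C)
    (hcol : IsNearestSiteColouring C P col) (he : maxEdgeLength C ≤ e) (heμ : 6 * e < μ)
    (heδ : 8 * ε * e < δ ^ 2) : delaunayComplex Ω P ⊆ discreteDelaunayComplex C P col := by
  classical
  intro σ hσ
  obtain ⟨hσne, hσP, -⟩ := id hσ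
  have : Nonempty σ := hσne.to_subtype
  obtain ⟨c, hc⟩ := exists_forall_isProtectedCentre hprot hσ
  have interpolation_mem : ∀ a ∈ cubeLowerFaces σ, cubeInterpolation c a ∈ Ω := by
    rintro a ⟨ha, i, hi⟩
    exact (cubeInterpolation_mem_voronoiCell hc (hconvex i (hσP i i.2)) ha hi).1
  have exists_ne_one : ∀ a ∈ cubeLowerFaces σ, ∀ q ∈ P,
      cubeInterpolation c a ∈ discreteVoronoiCell C col q → ∃ j : σ, ↑j = q ∧ a j ≠ 1 :=
    fun a ha q hq => exists_apply_ne_one_of_cubeInterpolation_mem_discreteVoronoiCell hnet hcol he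
      heμ heδ (v := fun i : σ => (i : EuclideanSpace ℝ (Fin n))) (fun i => hσP i i.2)
      (fun τ hτ => (hc τ hτ).2) ha (subset_closure (interpolation_mem a ha)) hq
  let g : cubeLowerFaces σ → Ω := fun a => ⟨cubeInterpolation c a, interpolation_mem a a.2⟩
  have g_continuous : Continuous g :=
    ((continuous_cubeInterpolation c).comp continuous_subtype_val).subtype_mk _
  obtain ⟨a, ha⟩ := nonempty_iInter_of_isClosed_of_forall_ne_one
    (B := fun i : σ => (↑) '' (g ⁻¹' ((↑) ⁻¹' discreteVoronoiCell C col i)))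
    (fun i => isCompact_cubeLowerFaces.isClosed.isClosedMap_subtype_val _
      ((isClosed_preimage_discreteVoronoiCell hC col i).preimage g_continuous))
    (fun a ha => by
      obtain ⟨q, hq, hmem⟩ := exists_mem_discreteVoronoiCell hC hcol (interpolation_mem a ha)
      obtain ⟨j, rfl, -⟩ := exists_ne_one a ha q hq hmem
      exact Set.mem_iUnion.2 ⟨j, ⟨a, ha⟩, hmem, rfl⟩)
    (by
      rintro i _ ⟨a, hmem, rfl⟩
      obtain ⟨j, hji, ne_one⟩ := exists_ne_one a a.2 i (hσP i i.2) hmem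
      rwa [Subtype.coe_injective hji] at ne_one)
  refine ⟨hσne, hσP, cubeInterpolation c a, Set.mem_iInter₂.2 fun p hp => ?_⟩
  obtain ⟨a, hmem, rfl⟩ := Set.mem_iInter.1 ha ⟨p, hp⟩
  exact hmem

theorem exists_maxEdgeLength_le_of_lt
    (hedge : maxEdgeLength C < ENNReal.ofReal (min (μ / 16) (δ ^ 2 / (64 * ε)))) :
    ∃ e : ℝ≥0, maxEdgeLength C ≤ e ∧ 0 < ε ∧ 16 * e < μ ∧ 64 * ε * e < δ ^ 2 := by
  obtain ⟨-, ratio_pos⟩ := lt_min_iff.1 (ENNReal.ofReal_pos.1 (bot_le.trans_lt hedge))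
  have ε_pos : 0 < ε := by
    by_contra! hle
    exact ratio_pos.not_ge (div_nonpos_of_nonneg_of_nonpos (sq_nonneg δ) (by linarith))
  lift maxEdgeLength C to ℝ≥0 using (hedge.trans_le le_top).ne with e
  obtain ⟨lt_μ, lt_δ⟩ := lt_min_iff.1 ((ENNReal.lt_ofReal_iff_toReal_lt ENNReal.coe_ne_top).1 hedge)
  rw [ENNReal.coe_toReal, lt_div_iff₀ (by positivity), mul_comm] at lt_μ lt_δ
  exact ⟨e, le_rfl, ε_pos, lt_μ, lt_δ⟩

end Delaunay

theorem mainTheorem2_general {n : ℕ} (Ω P : Set (EuclideanSpace ℝ (Fin n))) (ε μ δ : ℝ)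
    (hnet : IsNet Ω P ε μ)
    (hprot : IsPowerProtected Ω P δ)
    (hconvex : ∀ p ∈ P, Convex ℝ (voronoiCell Ω P p))
    (hboundary : delaunayComplex Ω P = delaunayComplex Set.univ P)
    (C : Geometry.SimplicialComplex ℝ (EuclideanSpace ℝ (Fin n)))
    (hC : IsCanvas Ω C)
    (col : EuclideanSpace ℝ (Fin n) → EuclideanSpace ℝ (Fin n))
    (hcol : IsNearestSiteColouring C P col)
    (e : NNReal) (hedge : maxEdgeLength C ≤ e) (heμ : 6 * e < μ) (heδ : 8 * ε * e < δ ^ 2) :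
    discreteDelaunayComplex C P col = delaunayComplex Ω P :=
  (discreteDelaunayComplex_subset hnet hprot hboundary hC hcol hedge heμ heδ).antisymm
    (delaunayComplex_subset hnet hprot hconvex hC hcol hedge heμ heδ)

theorem mainTheorem2 {n : ℕ} (Ω P : Set (EuclideanSpace ℝ (Fin n))) (ε μ δ : ℝ)
    (hΩ : IsOpen Ω)
    (hnet : IsNet Ω P ε μ)
    (hprot : IsPowerProtected Ω P δ)
    (hconvex : ∀ p ∈ P, Convex ℝ (voronoiCell Ω P p))
    (hboundary : delaunayComplex Ω P = delaunayComplex Set.univ P)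
    (C : Geometry.SimplicialComplex ℝ (EuclideanSpace ℝ (Fin n)))
    (hC : IsCanvas Ω C)
    (col : EuclideanSpace ℝ (Fin n) → EuclideanSpace ℝ (Fin n))
    (hcol : IsNearestSiteColouring C P col)
    (hedge : maxEdgeLength C < ENNReal.ofReal (min (μ / 16) (δ ^ 2 / (64 * ε)))) :
    discreteDelaunayComplex C P col = delaunayComplex Ω P := by
  obtain ⟨e, he, ε_pos, heμ, heδ⟩ := exists_maxEdgeLength_le_of_lt hedge
  exact mainTheorem2_general Ω P ε μ δ hnet hprot hconvex hboundary C hC col hcol e he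
    (by linarith [e.coe_nonneg]) (by linarith [mul_nonneg ε_pos.le e.coe_nonneg])
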